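/- Let $X$ be a smooth projective variety of dimension $n$ over $\mathbb{C}$ (a connected compact complex manifold that embeds in a projective space) with nonnegative Kodaira dimension, i.e. $H^0(X,mK_X)\neq 0$ for some $m\ge 1$. For a section $\sigma$ of $mK_X$, written locally as $\sigma=f\,(dz_1\wedge\dots\wedge dz_n)^{\otimes m}$, the form $|\sigma|^{2/m}=|(\sigma\wedge\bar\sigma)^{1/m}|$ is the nonnegative $(n,n)$-form $|f|^{2/m}\,|dz_1\wedge\dots\wedge dz_n\wedge d\bar z_1\wedge\dots\wedge d\bar z_n|$; similarly, for a line bundle $A$ with a hermitian metric $h_A$ and a section $\sigma$ of $A+mK_X$, $h_A^{1/m}|\sigma|^{2/m}=|h_A^{1/m}(\sigma\wedge\bar\sigma)^{1/m}|$ is a nonnegative $(n,n)$-form. The inverse of a nonnegative $(n,n)$-form is a metric on $K_X$ with values in $[0,+\infty]$, and the lower envelope of a metric is its lower semicontinuous envelope. Put $$K_m(x)=\sup\Big\{|\sigma|^{2/m}(x)\;:\;\sigma\in H^0(X,mK_X),\ \Big|\int_X(\sigma\wedge\bar\sigma)^{1/m}\Big|=1\Big\},$$ and let the canonical AZD $h_{can}$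 be the lower envelope of $\big(\limsup_{m\to\infty}K_m\big)^{-1}$ (here $\sup\emptyset=0$). For an ample line bundle $A$ on $X$ with a $C^\infty$ hermitian metric $h_A$ of strictly positive curvature, put $$\hat K_m^A(x)=\sup\Big\{|\sigma|^{2/m}(x)\;:\;\sigma\in H^0(X,A+mK_X),\ \Big|\int_X h_A^{1/m}(\sigma\wedge\bar\sigma)^{1/m}\Big|=1\Big\},$$ and let $\hat h_{can,A}$ be the lower envelope of $\big(\limsup_{m\to\infty}h_A^{1/m}\hat K_m^A\big)^{-1}$. Let the supercanonical AZD $\hat h_{can}$ be the lower envelope of the pointwise infimum $\inf_A\hat h_{can,A}$ over all ample line bundles $A$ (with metrics $h_A$ as above). Call $A$ sufficiently ample if it is ample and, for all line bundles $L$ with a singular hermitian metric $h_L$ of semipositive curvature current (i.e. with plurisubharmonic local weights, not identically $-\infty$), with multiplier ideal sheaf $\mathcal{I}(h_L)$: the sheaves $\mathcal{O}_X(A+L)\otimes\mathcal{I}(h_L)$ and $\mathcal{O}_X(K_X+A+L)\otimes\mathcal{I}(h_L)$ are globally generated; and, for a fixed $C^\infty$ volume form $dV$ and a constant $C$ independent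 of $(L,h_L)$, of $x\in X$ and of $v$, every $v\in(A+L)_x$ with $(h_Ah_L)(v,v)<\infty$ is the value at $x$ of some $\sigma\in H^0(X,\mathcal{O}_X(A+L)\otimes\mathcal{I}(h_L))$ with $\int_X|\sigma|^2h_Ah_L\,dV\le C\,(h_Ah_L)(v,v)$. Then for every sufficiently ample $A$ and every $h_A$ as above $$\hat h_{can,A}\le h_{can}$$ holds pointwise on $X$. In particular, $$\hat h_{can}\le h_{can}$$ holds pointwise on $X$. -/

import Mathlib

open scoped Manifold ContDiff ENNReal Topology
open MeasureTheory Filter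

noncomputable section

universe u

namespace CanonicalAZD

/-! ### Holomorphic line bundles

Throughout, `X` is a complex manifold of dimension `n`, modelled on `Fin n → ℂ`. -/

/-- A holomorphic line bundle on `X`, given by a trivializing open cover `dom i` and a holomorphic
cocycle. If `e i` is the frame over `dom i`, then `e j = trans i j • e i`, so a section
`f i • e i = f j • e j` satisfies `f i = trans i j * f j`. -/
structure HolLineBundle (n : ℕ) (X : Type u) [TopologicalSpace X]
    [ChartedSpace (Fin n → ℂ) X] where
  /-- the index set of the trivializing cover -/
  ι : Type u
  /-- the trivializing open sets -/
  dom : ι → Set X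
  isOpen_dom : ∀ i, IsOpen (dom i)
  /-- an index of a trivializing open set that contains the given point -/
  indexAt : X → ι
  mem_indexAt : ∀ x, x ∈ dom (indexAt x)
  /-- the transition functions -/
  trans : ι → ι → X → ℂ
  holo_trans : ∀ i j,
    ContMDiffOn 𝓘(ℂ, Fin n → ℂ) 𝓘(ℂ, ℂ) ω (trans i j) (dom i ∩ dom j)
  trans_self : ∀ i x, x ∈ dom i → trans i i x = 1
  trans_mul : ∀ i j k x, x ∈ dom i → x ∈ dom j → x ∈ dom k →
    trans i j x * trans j k x = trans i k x

namespace HolLineBundle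

variable {n : ℕ} {X : Type u} [TopologicalSpace X] [ChartedSpace (Fin n → ℂ) X]

/-- The tensor product of two line bundles (`A + B` in additive notation). -/
def tensor (A B : HolLineBundle n X) : HolLineBundle n X where
  ι := A.ι × B.ι
  dom i := A.dom i.1 ∩ B.dom i.2
  isOpen_dom i := (A.isOpen_dom i.1).inter (B.isOpen_dom i.2)
  indexAt x := (A.indexAt x, B.indexAt x)
  mem_indexAt x := ⟨A.mem_indexAt x, B.mem_indexAt x⟩
  trans i j x := A.trans i.1 j.1 x * B.trans i.2 j.2 x
  holo_trans i j :=
    ((A.holo_trans i.1 j.1).mono fun _ hx => ⟨hx.1.1, hx.2.1⟩).mul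
      ((B.holo_trans i.2 j.2).mono fun _ hx => ⟨hx.1.2, hx.2.2⟩)
  trans_self i x hx := by rw [A.trans_self _ _ hx.1, B.trans_self _ _ hx.2, one_mul]
  trans_mul i j k x hi hj hk := by
    rw [← A.trans_mul i.1 j.1 k.1 x hi.1 hj.1 hk.1, ← B.trans_mul i.2 j.2 k.2 x hi.2 hj.2 hk.2]
    ring

/-- The tensor power of a line bundle (`m A` in additive notation). -/
def pow (A : HolLineBundle n X) (m : ℕ) : HolLineBundle n X where
  ι := A.ι
  dom := A.dom
  isOpen_dom := A.isOpen_dom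
  indexAt := A.indexAt
  mem_indexAt := A.mem_indexAt
  trans i j x := A.trans i j x ^ m
  holo_trans i j := (A.holo_trans i j).pow m
  trans_self i x hx := by rw [A.trans_self i x hx, one_pow]
  trans_mul i j k x hi hj hk := by rw [← mul_pow, A.trans_mul i j k x hi hj hk]

/-- A global holomorphic section, given by its coefficients in the frames. -/
structure HolSection (L : HolLineBundle n X) where
  /-- the coefficient of the section in the frame over `L.dom i` -/
  val : L.ι → X → ℂ
  holo : ∀ i, ContMDiffOn 𝓘(ℂ, Fin n → ℂ) 𝓘(ℂ, ℂ) ω (val i) (L.dom i)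
  compat : ∀ i j x, x ∈ L.dom i → x ∈ L.dom j → val i x = L.trans i j x * val j x

/-- `L` is very ample: finitely many global sections without common zeros define an injective
immersion `x ↦ [s 0 x : ⋯ : s N x]` of `X` into projective space (which is an embedding when `X`
is compact). -/
def IsVeryAmple (L : HolLineBundle n X) : Prop :=
  ∃ (N : ℕ) (s : Fin (N + 1) → L.HolSection),
    (∀ i x, x ∈ L.dom i → ∃ k, (s k).val i x ≠ 0) ∧
    (∀ i x j y, x ∈ L.dom i → y ∈ L.dom j →
      (∃ c : ℂ, ∀ k, (s k).val i x = c * (s k).val j y) → x = y) ∧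
    (∀ i x, x ∈ L.dom i → ∀ e ∈ atlas (Fin n → ℂ) X, x ∈ e.source → ∀ v : Fin n → ℂ,
      (∃ c : ℂ, ∀ k, fderiv ℂ ((s k).val i ∘ e.symm) (e x) v = c * (s k).val i x) → v = 0)

/-- `L` is ample: some positive tensor power of it is very ample. -/
def IsAmple (L : HolLineBundle n X) : Prop :=
  ∃ k : ℕ, 1 ≤ k ∧ (L.pow k).IsVeryAmple

/-- A `C^∞` hermitian metric on `L`, given by the squared lengths of the frames. -/
structure SmoothMetric (L : HolLineBundle n X) where
  /-- the squared length of the frame over `L.dom i` -/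
  val : L.ι → X → ℝ
  pos : ∀ i x, x ∈ L.dom i → 0 < val i x
  smooth : ∀ i, ContMDiffOn 𝓘(ℝ, Fin n → ℂ) 𝓘(ℝ, ℝ) ∞ (val i) (L.dom i)
  compat : ∀ i j x, x ∈ L.dom i → x ∈ L.dom j →
    val j x = ‖L.trans i j x‖ ^ 2 * val i x

/-- The curvature `-∂∂̄ log h` is strictly positive: in each chart the Levi form of the local
weight `φ = -log h` is positive definite; here `D²φ(v, v) + D²φ(iv, iv)` is four times the Levi
form `∑ φ_{j k̄} v_j v̄_k`. -/
def SmoothMetric.HasPositiveCurvature {L : HolLineBundle n X} (h : L.SmoothMetric) : Prop :=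
  ∀ i, ∀ e ∈ atlas (Fin n → ℂ) X, ∀ x, x ∈ L.dom i → x ∈ e.source → ∀ v : Fin n → ℂ, v ≠ 0 →
    0 < iteratedFDeriv ℝ 2 (fun z => -Real.log (h.val i (e.symm z))) (e x) ![v, v] +
      iteratedFDeriv ℝ 2 (fun z => -Real.log (h.val i (e.symm z))) (e x)
        ![Complex.I • v, Complex.I • v]

end HolLineBundle

/-! ### Plurisubharmonic functions and pseudoeffective singular hermitian line bundles -/

/-- Plurisubharmonic functions on an open set `U` of `ℂⁿ`, with values in `[-∞, ∞)`: upper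
semicontinuous, with the sub-mean value inequality on each closed complex disc in `U`. As `φ` may
take the value `-∞`, the inequality is written as `mean (C - φ) ≤ C - φ z`, where `C` is an upper
bound of `φ` on the boundary circle. The function `-∞` is allowed. -/
def IsPshOn {n : ℕ} (φ : (Fin n → ℂ) → EReal) (U : Set (Fin n → ℂ)) : Prop :=
  UpperSemicontinuousOn φ U ∧ (∀ z ∈ U, φ z ≠ ⊤) ∧
    ∀ z v : Fin n → ℂ, (∀ t : ℂ, ‖t‖ ≤ 1 → z + t • v ∈ U) →
      ∀ C : ℝ, (∀ θ : ℝ, φ (z + circleMap 0 1 θ • v) ≤ (C : EReal)) →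
        (((∫⁻ θ in Set.Ioc 0 (2 * Real.pi),
            ((C : EReal) - φ (z + circleMap 0 1 θ • v)).toENNReal) /
              ENNReal.ofReal (2 * Real.pi) : ℝ≥0∞) : EReal) ≤ (C : EReal) - φ z

namespace HolLineBundle

variable {n : ℕ} {X : Type u} [TopologicalSpace X] [ChartedSpace (Fin n → ℂ) X]

/-- A singular hermitian metric with semipositive curvature current on `L`: its local weights
`-log h` are plurisubharmonic, and it is not identically `+∞` (for connected `X` its local weights
are then locally integrable). A pair of `L` and such a metric is a pseudoeffective singular
hermitian line bundle. -/
structure PsefMetric (L : HolLineBundle n X) where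
  /-- the squared length of the frame over `L.dom i` -/
  val : L.ι → X → ℝ≥0∞
  compat : ∀ i j x, x ∈ L.dom i → x ∈ L.dom j →
    val j x = ‖L.trans i j x‖ₑ ^ 2 * val i x
  psh : ∀ i, ∀ e ∈ atlas (Fin n → ℂ) X,
    IsPshOn (fun z => -ENNReal.log (val i (e.symm z))) (e.target ∩ e.symm ⁻¹' L.dom i)
  nontrivial : ∃ i, ∃ x ∈ L.dom i, val i x ≠ ⊤

/-- The germ of `f` at `x` lies in the stalk at `x` of the multiplier ideal sheaf of `h`: `f` is
holomorphic and `|f|² h` is integrable near `x`. -/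
def PsefMetric.MemMultiplierIdeal {L : HolLineBundle n X} (h : L.PsefMetric) (x : X)
    (f : X → ℂ) : Prop :=
  ∃ V : Set X, IsOpen V ∧ x ∈ V ∧ V ⊆ L.dom (L.indexAt x) ∧
    V ⊆ (chartAt (Fin n → ℂ) x).source ∧
    ContMDiffOn 𝓘(ℂ, Fin n → ℂ) 𝓘(ℂ, ℂ) ω f V ∧
    ∫⁻ z in (chartAt (Fin n → ℂ) x).target ∩ (chartAt (Fin n → ℂ) x).symm ⁻¹' V,
      ‖f ((chartAt (Fin n → ℂ) x).symm z)‖ₑ ^ 2 *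
        h.val (L.indexAt x) ((chartAt (Fin n → ℂ) x).symm z) < ⊤

/-- `σ` is a global section of `O(M + L) ⊗ I(h)`. -/
def PsefMetric.IsMultiplierSection {L : HolLineBundle n X} (h : L.PsefMetric)
    {M : HolLineBundle n X} (σ : (M.tensor L).HolSection) : Prop :=
  ∀ x, h.MemMultiplierIdeal x (σ.val (M.indexAt x, L.indexAt x))

/-- The sheaf `O(M + L) ⊗ I(h)` is globally generated: at each point `x` every germ of it is a
combination of germs of global sections with coefficients in the local ring of holomorphic germs
at `x`. -/
def PsefMetric.GloballyGenerated {L : HolLineBundle n X} (h : L.PsefMetric)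
    (M : HolLineBundle n X) : Prop :=
  ∀ (x : X) (f : X → ℂ), h.MemMultiplierIdeal x f →
    ∃ (k : ℕ) (s : Fin k → (M.tensor L).HolSection) (g : Fin k → X → ℂ),
      (∀ j, h.IsMultiplierSection (s j)) ∧
      (∀ j, ContMDiffAt 𝓘(ℂ, Fin n → ℂ) 𝓘(ℂ, ℂ) ω (g j) x) ∧
      ∀ᶠ y in 𝓝 x, f y = ∑ j, g j y * (s j).val (M.indexAt x, L.indexAt x) y

end HolLineBundle

/-! ### The canonical bundle and integration -/

section Canonical

variable {n : ℕ} {X : Type u} [TopologicalSpace X]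

/-- The complex Jacobian determinant `det (∂z'_i / ∂z_j)` at `x` of the change of coordinates from
the chart `e = (z_1, …, z_n)` to the chart `e' = (z'_1, …, z'_n)`. -/
def jacobian (e e' : OpenPartialHomeomorph X (Fin n → ℂ)) (x : X) : ℂ :=
  Matrix.det (Matrix.of fun i j => fderiv ℂ (e' ∘ e.symm) (e x) (Pi.single j 1) i)

theorem contDiffAt_transition [ChartedSpace (Fin n → ℂ) X]
    [IsManifold 𝓘(ℂ, Fin n → ℂ) ω X]
    {e e' : OpenPartialHomeomorph X (Fin n → ℂ)}
    (he : e ∈ atlas (Fin n → ℂ) X) (he' : e' ∈ atlas (Fin n → ℂ) X) {x : X}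
    (hx : x ∈ e.source) (hx' : x ∈ e'.source) :
    ContDiffAt ℂ ω (e' ∘ e.symm) (e x) := by
  have h1 : ContMDiffAt 𝓘(ℂ, Fin n → ℂ) 𝓘(ℂ, Fin n → ℂ) ω e.symm (e x) :=
    contMDiffAt_symm_of_mem_maximalAtlas (IsManifold.subset_maximalAtlas he) (e.map_source hx)
  have h2 : ContMDiffAt 𝓘(ℂ, Fin n → ℂ) 𝓘(ℂ, Fin n → ℂ) ω e' (e.symm (e x)) :=
    contMDiffAt_of_mem_maximalAtlas (IsManifold.subset_maximalAtlas he')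
      (by rwa [e.left_inv hx])
  exact (h2.comp (e x) h1).contDiffAt

theorem contMDiffOn_jacobian [ChartedSpace (Fin n → ℂ) X]
    [IsManifold 𝓘(ℂ, Fin n → ℂ) ω X]
    {e e' : OpenPartialHomeomorph X (Fin n → ℂ)}
    (he : e ∈ atlas (Fin n → ℂ) X) (he' : e' ∈ atlas (Fin n → ℂ) X) :
    ContMDiffOn 𝓘(ℂ, Fin n → ℂ) 𝓘(ℂ, ℂ) ω (jacobian e e') (e.source ∩ e'.source) := by
  rintro x ⟨hx, hx'⟩
  have hd : ContDiffAt ℂ ω (fderiv ℂ (e' ∘ e.symm)) (e x) :=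
    (contDiffAt_transition he he' hx hx').fderiv_right le_rfl
  have hdet : ContDiffAt ℂ ω (fun z : Fin n → ℂ => Matrix.det
      (Matrix.of fun i j => fderiv ℂ (e' ∘ e.symm) z (Pi.single j 1) i)) (e x) := by
    simp only [Matrix.det_apply']
    refine ContDiffAt.sum fun p _ => contDiffAt_const.mul (contDiffAt_prod fun i _ => ?_)
    exact contDiffAt_pi.1 (hd.clm_apply contDiffAt_const) (p i)
  have hchart : ContMDiffAt 𝓘(ℂ, Fin n → ℂ) 𝓘(ℂ, Fin n → ℂ) ω e x :=
    contMDiffAt_of_mem_maximalAtlas (IsManifold.subset_maximalAtlas he) hx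
  exact (hdet.contMDiffAt.comp x hchart).contMDiffWithinAt

theorem jacobian_self (e : OpenPartialHomeomorph X (Fin n → ℂ)) {x : X} (hx : x ∈ e.source) :
    jacobian e e x = 1 := by
  have h : (e ∘ e.symm) =ᶠ[𝓝 (e x)] id := by
    filter_upwards [e.open_target.mem_nhds (e.map_source hx)] with z hz
    exact e.right_inv hz
  have h2 : (Matrix.of fun i j => fderiv ℂ (e ∘ e.symm) (e x) (Pi.single j 1) i) =
      (1 : Matrix (Fin n) (Fin n) ℂ) := by
    ext i j
    simp [h.fderiv_eq, Matrix.one_apply, Pi.single_apply]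
  rw [jacobian, h2, Matrix.det_one]

theorem jacobian_mul [ChartedSpace (Fin n → ℂ) X]
    [IsManifold 𝓘(ℂ, Fin n → ℂ) ω X]
    {e₁ e₂ e₃ : OpenPartialHomeomorph X (Fin n → ℂ)}
    (h₁ : e₁ ∈ atlas (Fin n → ℂ) X) (h₂ : e₂ ∈ atlas (Fin n → ℂ) X)
    (h₃ : e₃ ∈ atlas (Fin n → ℂ) X) {x : X}
    (hx₁ : x ∈ e₁.source) (hx₂ : x ∈ e₂.source) (hx₃ : x ∈ e₃.source) :
    jacobian e₁ e₂ x * jacobian e₂ e₃ x = jacobian e₁ e₃ x := by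
  have hev : (e₃ ∘ e₁.symm) =ᶠ[𝓝 (e₁ x)] (e₃ ∘ e₂.symm) ∘ (e₂ ∘ e₁.symm) := by
    have hc : ContinuousAt e₁.symm (e₁ x) := e₁.continuousAt_symm (e₁.map_source hx₁)
    have hm : e₂.source ∈ 𝓝 (e₁.symm (e₁ x)) := by
      rw [e₁.left_inv hx₁]; exact e₂.open_source.mem_nhds hx₂
    filter_upwards [hc hm] with z hz
    simp only [Function.comp_apply]
    rw [e₂.left_inv hz]
  have hpt : (e₂ ∘ e₁.symm) (e₁ x) = e₂ x := by
    simp only [Function.comp_apply]; rw [e₁.left_inv hx₁]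
  have d12 : DifferentiableAt ℂ (e₂ ∘ e₁.symm) (e₁ x) :=
    (contDiffAt_transition h₁ h₂ hx₁ hx₂).differentiableAt (by simp)
  have d23 : DifferentiableAt ℂ (e₃ ∘ e₂.symm) ((e₂ ∘ e₁.symm) (e₁ x)) := by
    rw [hpt]; exact (contDiffAt_transition h₂ h₃ hx₂ hx₃).differentiableAt (by simp)
  have key : fderiv ℂ (e₃ ∘ e₁.symm) (e₁ x) =
      (fderiv ℂ (e₃ ∘ e₂.symm) (e₂ x)).comp (fderiv ℂ (e₂ ∘ e₁.symm) (e₁ x)) := by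
    rw [hev.fderiv_eq, fderiv_comp _ d23 d12, hpt]
  have hmat : ∀ f : (Fin n → ℂ) →L[ℂ] (Fin n → ℂ),
      (Matrix.of fun i j => f (Pi.single j 1) i) =
        LinearMap.toMatrix' (f : (Fin n → ℂ) →ₗ[ℂ] (Fin n → ℂ)) := by
    intro f
    ext i j
    simp [LinearMap.toMatrix'_apply]
  simp only [jacobian, hmat]
  rw [key, ContinuousLinearMap.toLinearMap_comp, LinearMap.toMatrix'_comp, Matrix.det_mul, mul_comm]

end Canonical

/-- The canonical bundle `K_X`, trivialized over each chart `e = (z_1, …, z_n)` of the atlas by the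
frame `dz_1 ∧ ⋯ ∧ dz_n`. A section of `m K_X` is thus locally `f_e (dz_1 ∧ ⋯ ∧ dz_n)^m`. -/
def canonicalBundle (n : ℕ) (X : Type u) [TopologicalSpace X] [ChartedSpace (Fin n → ℂ) X]
    [IsManifold 𝓘(ℂ, Fin n → ℂ) ω X] : HolLineBundle n X where
  ι := atlas (Fin n → ℂ) X
  dom e := e.1.source
  isOpen_dom e := e.1.open_source
  indexAt x := ⟨chartAt (Fin n → ℂ) x, chart_mem_atlas _ x⟩
  mem_indexAt x := mem_chart_source _ x
  trans e e' := jacobian e.1 e'.1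
  holo_trans e e' := contMDiffOn_jacobian e.2 e'.2
  trans_self e _ hx := jacobian_self e.1 hx
  trans_mul e₁ e₂ e₃ _ h₁ h₂ h₃ := jacobian_mul e₁.2 e₂.2 e₃.2 h₁ h₂ h₃

section Metrics

variable {n : ℕ} {X : Type u} [TopologicalSpace X] [ChartedSpace (Fin n → ℂ) X]

/-- The measure `|dz_1 ∧ ⋯ ∧ dz_n ∧ dz̄_1 ∧ ⋯ ∧ dz̄_n|`, which is `2ⁿ` times Lebesgue measure, of
the chart `e`, as a measure on `X`. -/
def chartVolume [MeasurableSpace X] (e : OpenPartialHomeomorph X (Fin n → ℂ)) : Measure X :=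
  ((2 : ℝ≥0∞) ^ n • (volume : Measure (Fin n → ℂ)).restrict e.target).map e.symm

/-- The integral over `X` of the nonnegative `(n, n)`-form which is `ρ e |dz ∧ dz̄|` in the chart
`e`. The measures `ρ e |dz ∧ dz̄|` of the charts agree on overlaps, so the measure on `X` that they
define together is their supremum in the lattice of measures. -/
def integralForm [MeasurableSpace X] (ρ : atlas (Fin n → ℂ) X → X → ℝ≥0∞) : ℝ≥0∞ :=
  (⨆ e : atlas (Fin n → ℂ) X, (chartVolume e.1).withDensity (ρ e)) Set.univ

/-- The lower (semicontinuous) envelope of the local coefficients of a metric. -/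
def lowerEnvelope (h : atlas (Fin n → ℂ) X → X → ℝ≥0∞) : atlas (Fin n → ℂ) X → X → ℝ≥0∞ :=
  fun e x => liminf (h e) (𝓝 x)

/-- Pointwise inequality of two metrics on `K_X`, given by the squared lengths `h e` of the frames
`dz_1 ∧ ⋯ ∧ dz_n` of the charts `e`, with values in `[0, ∞]`. -/
def MetricLE (h h' : atlas (Fin n → ℂ) X → X → ℝ≥0∞) : Prop :=
  ∀ (e : atlas (Fin n → ℂ) X) (x : X), x ∈ e.1.source → h e x ≤ h' e x

variable [IsManifold 𝓘(ℂ, Fin n → ℂ) ω X]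

/-- The line bundle `A + m K_X`. -/
abbrev twist (A : HolLineBundle n X) (m : ℕ) : HolLineBundle n X :=
  A.tensor ((canonicalBundle n X).pow m)

/-- The coefficient of `|σ|^(2/m) = (σ ∧ σ̄)^(1/m)` with respect to `|dz ∧ dz̄|` in the chart `e`,
for a section `σ` of `m K_X`. -/
def pluriDensity (m : ℕ) (σ : ((canonicalBundle n X).pow m).HolSection)
    (e : atlas (Fin n → ℂ) X) (x : X) : ℝ≥0∞ :=
  ‖σ.val e x‖ₑ ^ (2 / (m : ℝ))

/-- The coefficient of `h_A^(1/m) |σ|^(2/m) = h_A^(1/m) (σ ∧ σ̄)^(1/m)` with respect to `|dz ∧ dz̄|`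
in the chart `e`, for a section `σ` of `A + m K_X`. It does not depend on the frame of `A`. -/
def twistedDensity (A : HolLineBundle n X) (hA : A.SmoothMetric) (m : ℕ)
    (σ : (twist A m).HolSection) (e : atlas (Fin n → ℂ) X) (x : X) : ℝ≥0∞ :=
  ENNReal.ofReal (hA.val (A.indexAt x) x) ^ (1 / (m : ℝ)) *
    ‖σ.val (A.indexAt x, e) x‖ₑ ^ (2 / (m : ℝ))

/-- `h_A |σ|² h_L dV` for a section `σ` of `A + L`, as a density; the `C^∞` volume form `dV` is
given as the inverse of a `C^∞` hermitian metric `w` on `K_X`. -/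
def l2Density {A L : HolLineBundle n X} (hA : A.SmoothMetric) (hL : L.PsefMetric)
    (w : (canonicalBundle n X).SmoothMetric) (σ : (A.tensor L).HolSection)
    (e : atlas (Fin n → ℂ) X) (x : X) : ℝ≥0∞ :=
  ‖σ.val (A.indexAt x, L.indexAt x) x‖ₑ ^ 2 * ENNReal.ofReal (hA.val (A.indexAt x) x) *
    hL.val (L.indexAt x) x * (ENNReal.ofReal (w.val e x))⁻¹

variable [MeasurableSpace X]

/-- `L²` interpolation at points: there are a `C^∞` volume form `dV` and a constant `C` such that
for all pseudoeffective `(L, h_L)` and all points `x`, each vector `v` of the fibre of `A + L` at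
`x` with finite length is the value at `x` of a section of `O(A + L) ⊗ I(h_L)` whose squared `L²`
norm is at most `C` times the squared length of `v`. (As the fibre is one-dimensional, this is the
existence of bounded linear interpolation operators with uniformly bounded norms.) -/
def HasInterpolation (A : HolLineBundle n X) (hA : A.SmoothMetric) : Prop :=
  ∃ (w : (canonicalBundle n X).SmoothMetric) (C : NNReal),
    ∀ (L : HolLineBundle n X) (hL : L.PsefMetric) (x : X) (v : ℂ),
      ‖v‖ₑ ^ 2 * ENNReal.ofReal (hA.val (A.indexAt x) x) * hL.val (L.indexAt x) x ≠ ⊤ →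
      ∃ σ : (A.tensor L).HolSection, hL.IsMultiplierSection σ ∧
        σ.val (A.indexAt x, L.indexAt x) x = v ∧
        integralForm (l2Density hA hL w σ) ≤
          C * (‖v‖ₑ ^ 2 * ENNReal.ofReal (hA.val (A.indexAt x) x) * hL.val (L.indexAt x) x)

/-- `A` is sufficiently ample (with `h_A` the metric on it used in the `L²` norms). -/
def IsSufficientlyAmple (A : HolLineBundle n X) (hA : A.SmoothMetric) : Prop :=
  A.IsAmple ∧
  (∀ (L : HolLineBundle n X) (hL : L.PsefMetric),
    hL.GloballyGenerated A ∧ hL.GloballyGenerated ((canonicalBundle n X).tensor A)) ∧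
  HasInterpolation A hA

/-- The extremal form `K_m`: the supremum of `|σ|^(2/m)` over the sections `σ` of `m K_X` with
`|∫ (σ ∧ σ̄)^(1/m)| = 1`; it is `0` if there are none. -/
def extremal (m : ℕ) (e : atlas (Fin n → ℂ) X) (x : X) : ℝ≥0∞ :=
  ⨆ (σ : ((canonicalBundle n X).pow m).HolSection) (_ : integralForm (pluriDensity m σ) = 1),
    pluriDensity m σ e x

/-- The canonical AZD `h_can`: the lower envelope of the inverse of `limsup K_m`. -/
def hCan : atlas (Fin n → ℂ) X → X → ℝ≥0∞ :=
  lowerEnvelope fun e x => (limsup (fun m : ℕ => extremal m e x) atTop)⁻¹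

/-- The form `h_A^(1/m) K̂_m^A`, where `K̂_m^A` is the supremum of `|σ|^(2/m)` over the sections `σ`
of `A + m K_X` with `|∫ h_A^(1/m) (σ ∧ σ̄)^(1/m)| = 1`. -/
def extremalTwisted (A : HolLineBundle n X) (hA : A.SmoothMetric) (m : ℕ)
    (e : atlas (Fin n → ℂ) X) (x : X) : ℝ≥0∞ :=
  ⨆ (σ : (twist A m).HolSection) (_ : integralForm (twistedDensity A hA m σ) = 1),
    twistedDensity A hA m σ e x

/-- The metric `ĥ_{can,A}`: the lower envelope of the inverse of `limsup h_A^(1/m) K̂_m^A`. -/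
def hHatCanOf (A : HolLineBundle n X) (hA : A.SmoothMetric) :
    atlas (Fin n → ℂ) X → X → ℝ≥0∞ :=
  lowerEnvelope fun e x => (limsup (fun m : ℕ => extremalTwisted A hA m e x) atTop)⁻¹

/-- The supercanonical AZD `ĥ_can`: the lower envelope of the pointwise infimum of `ĥ_{can,A}` over
all ample line bundles `A` with `C^∞` metrics of strictly positive curvature. -/
def hHatCan : atlas (Fin n → ℂ) X → X → ℝ≥0∞ :=
  lowerEnvelope fun e x =>
    ⨅ (A : HolLineBundle n X) (_ : A.IsAmple) (hA : A.SmoothMetric) (_ : hA.HasPositiveCurvature),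
      hHatCanOf A hA e x

end Metrics

/-- `X` is projective: it carries a very ample line bundle, that is, it has an embedding into a
projective space. -/
def IsProjective (n : ℕ) (X : Type u) [TopologicalSpace X] [ChartedSpace (Fin n → ℂ) X] : Prop :=
  ∃ L : HolLineBundle n X, L.IsVeryAmple

/-- `X` has nonnegative Kodaira dimension: `m K_X` has a nonzero section for some `m ≥ 1`. -/
def HasNonnegKodairaDim (n : ℕ) (X : Type u) [TopologicalSpace X] [ChartedSpace (Fin n → ℂ) X]
    [IsManifold 𝓘(ℂ, Fin n → ℂ) ω X] : Prop :=
  ∃ m : ℕ, 1 ≤ m ∧ ∃ σ : ((canonicalBundle n X).pow m).HolSection,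
    ∃ (e : atlas (Fin n → ℂ) X) (x : X), x ∈ e.1.source ∧ σ.val e x ≠ 0

end CanonicalAZD

end

open CanonicalAZD

/-! A section `σ` of `m K_X` becomes a section `τ ⊗ σ` of `A + m K_X` after tensoring with a fixed
section `τ` of `A`. Since `|τ|²_{h_A}` is bounded by a constant `M` on the compact manifold `X`,
`|τ(x)|_{h_A}^{2/m} K_m(x) ≤ M^{1/m} h_A^{1/m} K̂_m^A(x)`. If `τ(x) ≠ 0`, both constants tend to `1`
as `m → ∞`, so `limsup K_m ≤ limsup h_A^{1/m} K̂_m^A` at `x`. For a sufficiently ample `A`, a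
section `τ` with `τ(x) ≠ 0` is given by `L²` interpolation of the value `1` at `x`, with the trivial
bundle as `L`. For `ĥ_can` it is enough to compare with one ample bundle: a very ample one, whose
Fubini–Study metric is positively curved by the strict Cauchy–Schwarz inequality. -/

noncomputable section

universe u

namespace CanonicalAZD

open scoped NNReal InnerProductSpace

section ExtendedNonneg

theorem limsup_le_limsup_of_tendsto_one {ι : Type*} {f : Filter ι} [f.NeBot]
    {a b u v : ι → ℝ≥0∞} (ha : Tendsto a f (𝓝 1)) (hb : Tendsto b f (𝓝 1))
    (h : ∀ᶠ i in f, a i * u i ≤ b i * v i) : limsup u f ≤ limsup v f :=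
  calc limsup u f = limsup u f * liminf a f := by rw [ha.liminf_eq, mul_one]
    _ ≤ limsup (u * a) f := ENNReal.le_limsup_mul
    _ ≤ limsup (b * v) f := limsup_le_limsup <| h.mono fun i hi => by
        simpa only [Pi.mul_apply, mul_comm (u i)] using hi
    _ ≤ limsup b f * limsup v f :=
        ENNReal.limsup_mul_le' (by simp [hb.limsup_eq]) (by simp [hb.limsup_eq])
    _ = limsup v f := by rw [hb.limsup_eq, one_mul]

theorem tendsto_coe_rpow_one_div_one {c : ℝ≥0} (hc : c ≠ 0) :
    Tendsto (fun m : ℕ => (c : ℝ≥0∞) ^ (1 / (m : ℝ))) atTop (𝓝 1) := by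
  have h : Tendsto (fun m : ℕ => c ^ (1 / (m : ℝ))) atTop (𝓝 1) := by
    simpa using
      (tendsto_const_nhds (x := c)).nnrpow tendsto_one_div_atTop_nhds_zero_nat (Or.inl hc)
  refine (ENNReal.tendsto_coe.2 h).congr fun m => ?_
  exact ENNReal.coe_rpow_of_nonneg c (by positivity)

theorem exists_enorm_rpow_eq {p : ℝ} (hp : 0 < p) {a : ℝ≥0∞} (ha : a ≠ ⊤) :
    ∃ c : ℂ, ‖c‖ₑ ^ p = a := by
  lift a to ℝ≥0 using ha
  refine ⟨((a ^ p⁻¹ : ℝ≥0) : ℝ), ?_⟩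
  rw [enorm_eq_nnnorm, Complex.nnnorm_real, Real.nnnorm_of_nonneg (NNReal.coe_nonneg _),
    ← ENNReal.coe_rpow_of_nonneg _ hp.le]
  exact congrArg _ (NNReal.rpow_inv_rpow hp.ne' a)

theorem coe_mul_nnnorm_sq_rpow (a : ℝ≥0) (z : ℂ) (m : ℕ) :
    ((a * ‖z‖₊ ^ 2 : ℝ≥0) : ℝ≥0∞) ^ (1 / (m : ℝ)) =
      (a : ℝ≥0∞) ^ (1 / (m : ℝ)) * ‖z‖ₑ ^ (2 / (m : ℝ)) := by
  rw [ENNReal.coe_mul, ENNReal.mul_rpow_of_nonneg _ _ (by positivity), ENNReal.coe_pow,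
    ← ENNReal.rpow_natCast, ← ENNReal.rpow_mul, Nat.cast_ofNat, mul_one_div]
  rfl

end ExtendedNonneg

section Envelope

variable {n : ℕ} {X : Type u} [TopologicalSpace X] [ChartedSpace (Fin n → ℂ) X]
  {h h' h'' : atlas (Fin n → ℂ) X → X → ℝ≥0∞}

theorem MetricLE.trans (hle : MetricLE h h') (hle' : MetricLE h' h'') : MetricLE h h'' :=
  fun e x hx => (hle e x hx).trans (hle' e x hx)

theorem lowerEnvelope_le (h : atlas (Fin n → ℂ) X → X → ℝ≥0∞) : MetricLE (lowerEnvelope h) h :=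
  fun _ _ _ => liminf_le_of_frequently_le' fun hlt => hlt.self_of_nhds le_rfl

theorem MetricLE.lowerEnvelope (hle : MetricLE h h') :
    MetricLE (lowerEnvelope h) (lowerEnvelope h') := fun e _ hx =>
  liminf_le_liminf <| eventually_of_mem (e.1.open_source.mem_nhds hx) (hle e)

end Envelope

section ChartVolume

variable {n : ℕ} {X : Type u} [TopologicalSpace X] [MeasurableSpace X] [BorelSpace X]

theorem aemeasurable_symm (e : OpenPartialHomeomorph X (Fin n → ℂ)) :
    AEMeasurable e.symm ((2 : ℝ≥0∞) ^ n • (volume : Measure (Fin n → ℂ)).restrict e.target) :=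
  (e.continuousOn_symm.aemeasurable e.open_target.measurableSet).smul_measure _

theorem ae_chartVolume_mem_source (e : OpenPartialHomeomorph X (Fin n → ℂ)) :
    ∀ᵐ x ∂chartVolume e, x ∈ e.source := by
  refine (ae_map_iff (aemeasurable_symm e) e.open_source.measurableSet).2
    (Measure.ae_smul_measure ?_ _)
  filter_upwards [ae_restrict_mem e.open_target.measurableSet] with z hz
  exact e.map_target hz

theorem chartVolume_pos (e : OpenPartialHomeomorph X (Fin n → ℂ)) {x : X} (hx : x ∈ e.source)
    {V : Set X} (hV : IsOpen V) (hxV : x ∈ V) : 0 < chartVolume e V := by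
  have hopen : IsOpen (e.symm ⁻¹' V ∩ e.target) := by
    rw [Set.inter_comm]
    exact e.isOpen_inter_preimage_symm hV
  have hne : (e.symm ⁻¹' V ∩ e.target).Nonempty :=
    ⟨e x, by simpa only [Set.mem_preimage, e.left_inv hx] using hxV, e.map_source hx⟩
  rw [chartVolume, Measure.map_apply_of_aemeasurable (aemeasurable_symm e) hV.measurableSet,
    Measure.smul_apply, Measure.restrict_apply' e.open_target.measurableSet, smul_eq_mul]
  exact ENNReal.mul_pos (by simp) (hopen.measure_pos _ hne).ne'

end ChartVolume

section IntegralForm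

variable {n : ℕ} {X : Type u} [TopologicalSpace X] [MeasurableSpace X]
  [ChartedSpace (Fin n → ℂ) X] {ρ ρ' : atlas (Fin n → ℂ) X → X → ℝ≥0∞}

theorem withDensity_chartVolume_le (ρ : atlas (Fin n → ℂ) X → X → ℝ≥0∞)
    (e : atlas (Fin n → ℂ) X) (V : Set X) :
    (chartVolume e.1).withDensity (ρ e) V ≤ integralForm ρ :=
  (measure_mono (Set.subset_univ V)).trans <| Measure.le_iff'.1
    (le_iSup (fun e : atlas (Fin n → ℂ) X => (chartVolume e.1).withDensity (ρ e)) e) Set.univ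

theorem integralForm_const_mul {c : ℝ≥0∞} (hc : c ≠ ⊤)
    (ρ : atlas (Fin n → ℂ) X → X → ℝ≥0∞) :
    integralForm (fun e x => c * ρ e x) = c * integralForm ρ := by
  have hle {c : ℝ≥0∞} (hc : c ≠ ⊤) (ρ : atlas (Fin n → ℂ) X → X → ℝ≥0∞) :
      integralForm (fun e x => c * ρ e x) ≤ c * integralForm ρ := by
    rw [integralForm, integralForm, ← smul_eq_mul, ← Measure.smul_apply]
    refine Measure.le_iff'.1 (iSup_le fun e => ?_) _
    rw [show (fun x => c * ρ e x) = c • ρ e from rfl, withDensity_smul' _ _ hc]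
    gcongr
    exact le_iSup (fun e : atlas (Fin n → ℂ) X => (chartVolume e.1).withDensity (ρ e)) e
  obtain rfl | h0 := eq_or_ne c 0
  · exact le_antisymm (hle hc ρ) (by simp)
  refine le_antisymm (hle hc ρ) ?_
  rw [ENNReal.mul_le_iff_le_inv h0 hc]
  simpa only [← mul_assoc, ENNReal.inv_mul_cancel h0 hc, one_mul] using
    hle (ENNReal.inv_ne_top.2 h0) fun e x => c * ρ e x

variable [BorelSpace X]

theorem integralForm_mono (h : ∀ e : atlas (Fin n → ℂ) X, ∀ x ∈ e.1.source, ρ e x ≤ ρ' e x) :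
    integralForm ρ ≤ integralForm ρ' := by
  refine Measure.le_iff'.1 (iSup_mono fun e => withDensity_mono ?_) _
  filter_upwards [ae_chartVolume_mem_source e.1] with x hx
  exact h e x hx

theorem integralForm_pos {e : atlas (Fin n → ℂ) X} {x : X} (hx : x ∈ e.1.source)
    (hρ : LowerSemicontinuousAt (ρ e) x) (h0 : ρ e x ≠ 0) : 0 < integralForm ρ := by
  obtain ⟨δ, hδ0, hδ⟩ := exists_between (pos_iff_ne_zero.2 h0)
  obtain ⟨V, hVρ, hV, hxV⟩ := eventually_nhds_iff.1 (hρ δ hδ)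
  calc 0 < δ * chartVolume e.1 V := ENNReal.mul_pos hδ0.ne' (chartVolume_pos e.1 hx hV hxV).ne'
    _ = ∫⁻ _ in V, δ ∂chartVolume e.1 := (setLIntegral_const V δ).symm
    _ ≤ ∫⁻ y in V, ρ e y ∂chartVolume e.1 :=
        setLIntegral_mono' hV.measurableSet fun y hy => (hVρ y hy).le
    _ = (chartVolume e.1).withDensity (ρ e) V := (withDensity_apply _ hV.measurableSet).symm
    _ ≤ integralForm ρ := withDensity_chartVolume_le ρ e V

end IntegralForm

theorem isPshOn_const {n : ℕ} {c : EReal} (hc : c ≠ ⊤) (U : Set (Fin n → ℂ)) :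
    IsPshOn (fun _ => c) U := by
  refine ⟨upperSemicontinuousOn_const, fun _ _ => hc, fun z v _ C hC => ?_⟩
  have hperiod : ENNReal.ofReal (2 * Real.pi) ≠ 0 := by simp [Real.pi_pos]
  have hnonneg : 0 ≤ (C : EReal) - c :=
    (EReal.sub_nonneg (Or.inl (EReal.coe_ne_top C)) (Or.inl (EReal.coe_ne_bot C))).2 (hC 0)
  rw [setLIntegral_const, Real.volume_Ioc, sub_zero, mul_div_assoc,
    ENNReal.div_self hperiod ENNReal.ofReal_ne_top, mul_one, EReal.coe_toENNReal hnonneg]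

namespace HolLineBundle

variable {n : ℕ} {X : Type u} [TopologicalSpace X] [ChartedSpace (Fin n → ℂ) X]

section TrivialBundle

/-- The trivial line bundle, with one global frame. -/
def trivial (n : ℕ) (X : Type u) [TopologicalSpace X] [ChartedSpace (Fin n → ℂ) X] :
    HolLineBundle n X where
  ι := PUnit
  dom _ := Set.univ
  isOpen_dom _ := isOpen_univ
  indexAt _ := PUnit.unit
  mem_indexAt _ := Set.mem_univ _
  trans _ _ _ := 1
  holo_trans _ _ := contMDiffOn_const
  trans_self _ _ _ := rfl
  trans_mul _ _ _ _ _ _ _ := one_mul 1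

/-- The flat metric on the trivial line bundle, in which the global frame has length `1`. -/
def trivialMetric [Nonempty X] : (trivial n X).PsefMetric where
  val _ _ := 1
  compat _ _ _ _ _ := by simp [trivial]
  psh _ _ _ := isPshOn_const (by simp) _
  nontrivial := ⟨PUnit.unit, Classical.arbitrary X, Set.mem_univ _, ENNReal.one_ne_top⟩

/-- A section of `A + O` as a section of `A`. -/
def HolSection.ofTensorTrivial {A : HolLineBundle n X} (σ : (A.tensor (trivial n X)).HolSection) :
    A.HolSection where
  val i := σ.val (i, PUnit.unit)
  holo i := (σ.holo (i, PUnit.unit)).mono fun _ hx => ⟨hx, Set.mem_univ _⟩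
  compat i j x hi hj := by
    simpa only [tensor, trivial, mul_one] using
      σ.compat (i, PUnit.unit) (j, PUnit.unit) x ⟨hi, Set.mem_univ _⟩ ⟨hj, Set.mem_univ _⟩

end TrivialBundle

section Sections

/-- The tensor product `τ ⊗ σ` of two sections. -/
def HolSection.tensor {A B : HolLineBundle n X} (τ : A.HolSection) (σ : B.HolSection) :
    (A.tensor B).HolSection where
  val i x := τ.val i.1 x * σ.val i.2 x
  holo i := ((τ.holo i.1).mono fun _ hx => hx.1).mul ((σ.holo i.2).mono fun _ hx => hx.2)
  compat i j x hi hj := by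
    rw [τ.compat i.1 j.1 x hi.1 hj.1, σ.compat i.2 j.2 x hi.2 hj.2]
    simp only [HolLineBundle.tensor]
    ring

/-- The product of a section with a constant. -/
def HolSection.smul {L : HolLineBundle n X} (c : ℂ) (σ : L.HolSection) : L.HolSection where
  val i x := c * σ.val i x
  holo i := contMDiffOn_const.mul (σ.holo i)
  compat i j x hi hj := by rw [σ.compat i j x hi hj]; ring

/-- `L` is globally generated: its sections have no common zeros. -/
def IsGloballyGenerated (L : HolLineBundle n X) : Prop :=
  ∀ x, ∃ τ : L.HolSection, τ.val (L.indexAt x) x ≠ 0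

theorem trans_ne_zero (L : HolLineBundle n X) {i j : L.ι} {x : X} (hi : x ∈ L.dom i)
    (hj : x ∈ L.dom j) : L.trans i j x ≠ 0 :=
  left_ne_zero_of_mul_eq_one ((L.trans_mul i j i x hi hj hi).trans (L.trans_self i x hi))

end Sections

namespace SmoothMetric

variable {A : HolLineBundle n X}

/-- The squared length of the local section `f i • e i`, whose coefficients `f i` in the frames
`e i` need only be meaningful near the points where the length is taken. -/
def lengthSq (hA : A.SmoothMetric) (f : A.ι → X → ℂ) (x : X) : ℝ≥0 :=
  (hA.val (A.indexAt x) x).toNNReal * ‖f (A.indexAt x) x‖₊ ^ 2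

theorem lengthSq_mul (hA : A.SmoothMetric) (f : A.ι → X → ℂ) (g : X → ℂ) (x : X) :
    hA.lengthSq (fun i y => f i y * g y) x = hA.lengthSq f x * ‖g x‖₊ ^ 2 := by
  simp only [lengthSq, nnnorm_mul, mul_pow, mul_assoc]

theorem lengthSq_ne_zero (hA : A.SmoothMetric) {f : A.ι → X → ℂ} {x : X}
    (hf : f (A.indexAt x) x ≠ 0) : hA.lengthSq f x ≠ 0 :=
  mul_ne_zero (by simpa using hA.pos _ x (A.mem_indexAt x)) (by simpa using hf)

theorem lengthSq_eq (hA : A.SmoothMetric) {f : A.ι → X → ℂ} {i : A.ι} {x : X}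
    (hi : x ∈ A.dom i) (hf : f (A.indexAt x) x = A.trans (A.indexAt x) i x * f i x) :
    hA.lengthSq f x = (hA.val i x).toNNReal * ‖f i x‖₊ ^ 2 := by
  rw [lengthSq, hf, hA.compat _ i x (A.mem_indexAt x) hi, nnnorm_mul,
    Real.toNNReal_mul (by positivity), Real.toNNReal_pow (norm_nonneg _), norm_toNNReal]
  ring

theorem continuousOn_lengthSq (hA : A.SmoothMetric) {f : A.ι → X → ℂ} {U : Set X} (hU : IsOpen U)
    (hf : ∀ i, ContinuousOn (f i) (U ∩ A.dom i))
    (hcompat : ∀ i j, ∀ x ∈ U, x ∈ A.dom i → x ∈ A.dom j → f i x = A.trans i j x * f j x) :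
    ContinuousOn (hA.lengthSq f) U := fun x hx => by
  set i := A.indexAt x
  have hi : U ∩ A.dom i ∈ 𝓝 x := (hU.inter (A.isOpen_dom i)).mem_nhds ⟨hx, A.mem_indexAt x⟩
  have hval : ContinuousAt (hA.val i) x :=
    (hA.smooth i).continuousOn.continuousAt (mem_of_superset hi Set.inter_subset_right)
  have hframe : ContinuousAt (fun y => (hA.val i y).toNNReal * ‖f i y‖₊ ^ 2) x :=
    (continuous_real_toNNReal.continuousAt.comp hval).mul (((hf i).continuousAt hi).nnnorm.pow 2)
  refine (hframe.congr ?_).continuousWithinAt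
  filter_upwards [hi] with y hy
  exact (hA.lengthSq_eq hy.2 (hcompat _ i y hy.1 (A.mem_indexAt y) hy.2)).symm

theorem continuous_lengthSq (hA : A.SmoothMetric) (τ : A.HolSection) :
    Continuous (hA.lengthSq τ.val) :=
  continuousOn_univ.1 <| hA.continuousOn_lengthSq isOpen_univ
    (fun i => (τ.holo i).continuousOn.mono Set.inter_subset_right)
    fun i j x _ => τ.compat i j x

end SmoothMetric

end HolLineBundle

section Comparison

open HolLineBundle

variable {n : ℕ} {X : Type u} [TopologicalSpace X] [ChartedSpace (Fin n → ℂ) X]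
  [IsManifold 𝓘(ℂ, Fin n → ℂ) ω X] {A : HolLineBundle n X}

theorem twistedDensity_eq_lengthSq_rpow (hA : A.SmoothMetric) (m : ℕ) (σ : (twist A m).HolSection)
    (e : atlas (Fin n → ℂ) X) (x : X) :
    twistedDensity A hA m σ e x =
      (hA.lengthSq (fun i => σ.val (i, e)) x : ℝ≥0∞) ^ (1 / (m : ℝ)) := by
  rw [SmoothMetric.lengthSq, coe_mul_nnnorm_sq_rpow]
  rfl

theorem twistedDensity_smul (hA : A.SmoothMetric) (m : ℕ) (c : ℂ) (σ : (twist A m).HolSection) :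
    twistedDensity A hA m (σ.smul c) =
      fun e x => ‖c‖ₑ ^ (2 / (m : ℝ)) * twistedDensity A hA m σ e x := by
  funext e x
  simp only [twistedDensity, HolSection.smul]
  rw [enorm_mul, ENNReal.mul_rpow_of_nonneg _ _ (by positivity), mul_left_comm]

theorem twistedDensity_tensor (hA : A.SmoothMetric) (m : ℕ) (τ : A.HolSection)
    (σ : ((canonicalBundle n X).pow m).HolSection) (e : atlas (Fin n → ℂ) X) (x : X) :
    twistedDensity A hA m (τ.tensor σ) e x =
      (hA.lengthSq τ.val x : ℝ≥0∞) ^ (1 / (m : ℝ)) * pluriDensity m σ e x := by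
  have hlength : hA.lengthSq (fun i => (τ.tensor σ).val (i, e)) x =
      hA.lengthSq τ.val x * ‖σ.val e x‖₊ ^ 2 := hA.lengthSq_mul τ.val (σ.val e) x
  rw [twistedDensity_eq_lengthSq_rpow, hlength, coe_mul_nnnorm_sq_rpow, pluriDensity]

theorem continuousOn_twistedDensity (hA : A.SmoothMetric) (m : ℕ) (σ : (twist A m).HolSection)
    (e : atlas (Fin n → ℂ) X) : ContinuousOn (twistedDensity A hA m σ e) e.1.source := by
  have hlength : ContinuousOn (hA.lengthSq fun i => σ.val (i, e)) e.1.source := by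
    refine hA.continuousOn_lengthSq e.1.open_source
      (fun i => (σ.holo (i, e)).continuousOn.mono fun x hx => ⟨hx.2, hx.1⟩)
      fun i j x hx hi hj => ?_
    calc σ.val (i, e) x
        = A.trans i j x * (canonicalBundle n X).trans e e x ^ m * σ.val (j, e) x :=
          σ.compat (i, e) (j, e) x ⟨hi, hx⟩ ⟨hj, hx⟩
      _ = A.trans i j x * σ.val (j, e) x := by
          rw [(canonicalBundle n X).trans_self e x hx, one_pow, mul_one]
  rw [funext (twistedDensity_eq_lengthSq_rpow hA m σ e)]
  exact (ENNReal.continuous_rpow_const.comp ENNReal.continuous_coe).comp_continuousOn hlength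

variable [MeasurableSpace X] [BorelSpace X]

theorem twistedDensity_le_integralForm_mul (hA : A.SmoothMetric) {m : ℕ} (hm : m ≠ 0)
    (σ : (twist A m).HolSection) (hfin : integralForm (twistedDensity A hA m σ) ≠ ⊤)
    {e : atlas (Fin n → ℂ) X} {x : X} (hx : x ∈ e.1.source) :
    twistedDensity A hA m σ e x ≤
      integralForm (twistedDensity A hA m σ) * extremalTwisted A hA m e x := by
  obtain hσ | hσ := eq_or_ne (twistedDensity A hA m σ e x) 0
  · simp only [hσ, zero_le]
  have hcont : ContinuousAt (twistedDensity A hA m σ e) x :=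
    (continuousOn_twistedDensity hA m σ e).continuousAt (e.1.open_source.mem_nhds hx)
  have hpos : integralForm (twistedDensity A hA m σ) ≠ 0 :=
    (integralForm_pos hx hcont.lowerSemicontinuousAt hσ).ne'
  obtain ⟨c, hc⟩ := exists_enorm_rpow_eq (p := 2 / m) (by positivity) (ENNReal.inv_ne_top.2 hpos)
  have hnormalized : integralForm (twistedDensity A hA m (σ.smul c)) = 1 := by
    rw [twistedDensity_smul, hc, integralForm_const_mul (ENNReal.inv_ne_top.2 hpos),
      ENNReal.inv_mul_cancel hpos hfin]
  rw [← ENNReal.inv_mul_le_iff hpos hfin, ← hc]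
  calc ‖c‖ₑ ^ (2 / (m : ℝ)) * twistedDensity A hA m σ e x
      = twistedDensity A hA m (σ.smul c) e x := by rw [twistedDensity_smul]
    _ ≤ extremalTwisted A hA m e x := le_iSup₂_of_le (σ.smul c) hnormalized le_rfl

theorem lengthSq_rpow_mul_extremal_le (hA : A.SmoothMetric) (τ : A.HolSection) {M : ℝ≥0}
    (hM : ∀ y, hA.lengthSq τ.val y ≤ M) {m : ℕ} (hm : m ≠ 0) {e : atlas (Fin n → ℂ) X} {x : X}
    (hx : x ∈ e.1.source) :
    (hA.lengthSq τ.val x : ℝ≥0∞) ^ (1 / (m : ℝ)) * extremal m e x ≤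
      (M : ℝ≥0∞) ^ (1 / (m : ℝ)) * extremalTwisted A hA m e x := by
  have hMtop : (M : ℝ≥0∞) ^ (1 / (m : ℝ)) ≠ ⊤ :=
    ENNReal.rpow_ne_top_of_nonneg (by positivity) ENNReal.coe_ne_top
  simp only [extremal, ENNReal.mul_iSup]
  refine iSup₂_le fun σ hσ => ?_
  have hintegral : integralForm (twistedDensity A hA m (τ.tensor σ)) ≤
      (M : ℝ≥0∞) ^ (1 / (m : ℝ)) := by
    rw [← mul_one (_ ^ _), ← hσ, ← integralForm_const_mul hMtop]
    refine integralForm_mono fun e y _ => ?_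
    rw [twistedDensity_tensor]
    gcongr
    exact hM y
  calc (hA.lengthSq τ.val x : ℝ≥0∞) ^ (1 / (m : ℝ)) * pluriDensity m σ e x
      = twistedDensity A hA m (τ.tensor σ) e x := (twistedDensity_tensor hA m τ σ e x).symm
    _ ≤ _ := twistedDensity_le_integralForm_mul hA hm _ (ne_top_of_le_ne_top hMtop hintegral) hx
    _ ≤ _ := by gcongr

theorem limsup_extremal_le [CompactSpace X] (hA : A.SmoothMetric) {τ : A.HolSection}
    {e : atlas (Fin n → ℂ) X} {x : X} (hx : x ∈ e.1.source) (hτ : τ.val (A.indexAt x) x ≠ 0) :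
    limsup (fun m : ℕ => extremal m e x) atTop ≤
      limsup (fun m : ℕ => extremalTwisted A hA m e x) atTop := by
  obtain ⟨M, hM⟩ := (isCompact_range (hA.continuous_lengthSq τ)).bddAbove
  rw [mem_upperBounds, Set.forall_mem_range] at hM
  have hlength := hA.lengthSq_ne_zero hτ
  have hM0 : M ≠ 0 := (hlength.bot_lt.trans_le (hM x)).ne'
  refine limsup_le_limsup_of_tendsto_one (tendsto_coe_rpow_one_div_one hlength)
    (tendsto_coe_rpow_one_div_one hM0) ?_
  filter_upwards [eventually_ne_atTop 0] with m hm
  exact lengthSq_rpow_mul_extremal_le hA τ hM hm hx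

theorem HolLineBundle.IsGloballyGenerated.hHatCanOf_le_hCan [CompactSpace X]
    (hgen : A.IsGloballyGenerated) (hA : A.SmoothMetric) : MetricLE (hHatCanOf A hA) hCan := by
  refine MetricLE.lowerEnvelope fun e x hx => ?_
  obtain ⟨τ, hτ⟩ := hgen x
  exact ENNReal.inv_le_inv.2 (limsup_extremal_le hA hx hτ)

end Comparison

section Interpolation

open HolLineBundle

variable {n : ℕ} {X : Type u} [TopologicalSpace X] [ChartedSpace (Fin n → ℂ) X]
  [IsManifold 𝓘(ℂ, Fin n → ℂ) ω X] [MeasurableSpace X] {A : HolLineBundle n X}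

theorem HasInterpolation.isGloballyGenerated {hA : A.SmoothMetric} (h : HasInterpolation A hA) :
    A.IsGloballyGenerated := by
  intro x
  have : Nonempty X := ⟨x⟩
  obtain ⟨w, C, hC⟩ := h
  obtain ⟨σ, -, hσ, -⟩ := hC (trivial n X) trivialMetric x 1
    (by simp [HolLineBundle.trivialMetric])
  exact ⟨HolSection.ofTensorTrivial σ, (hσ.trans_ne one_ne_zero :)⟩

theorem hHatCan_le_hHatCanOf (hample : A.IsAmple) {hA : A.SmoothMetric}
    (hpos : hA.HasPositiveCurvature) : MetricLE hHatCan (hHatCanOf A hA) :=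
  (lowerEnvelope_le _).trans fun _ _ _ => iInf₂_le_of_le A hample (iInf₂_le hA hpos)

end Interpolation

section SecondDerivative

variable {E G H : Type*} [NormedAddCommGroup E] [NormedSpace ℝ E] [NormedAddCommGroup G]
  [NormedSpace ℝ G] [NormedAddCommGroup H] [InnerProductSpace ℝ H]

theorem hasLineDerivAt_fderiv_apply {f : E → G} {z : E} (hf : ContDiffAt ℝ 2 f z) (w : E) :
    HasLineDerivAt ℝ (fun y => fderiv ℝ f y w) (iteratedFDeriv ℝ 2 f z ![w, w]) z w := by
  have hdiff : DifferentiableAt ℝ (fderiv ℝ f) z :=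
    (hf.fderiv_right (m := 1) le_rfl).differentiableAt one_ne_zero
  simpa [iteratedFDeriv_two_apply] using
    (hdiff.hasFDerivAt.clm_apply (hasFDerivAt_const w z)).hasLineDerivAt w

theorem fderiv_log_norm_sq_apply {F : E → H} {z : E} (hF : DifferentiableAt ℝ F z) (h0 : F z ≠ 0)
    (w : E) :
    fderiv ℝ (fun y => Real.log (‖F y‖ ^ 2)) z w =
      2 * ⟪F z, fderiv ℝ F z w⟫_ℝ / ‖F z‖ ^ 2 := by
  rw [(hF.hasFDerivAt.norm_sq.log (by simpa using h0)).fderiv]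
  simp [div_eq_inv_mul]

theorem iteratedFDeriv_two_log_norm_sq {F : E → H} {z : E} (hF : ContDiffAt ℝ 2 F z)
    (h0 : F z ≠ 0) (w : E) :
    iteratedFDeriv ℝ 2 (fun y => Real.log (‖F y‖ ^ 2)) z ![w, w] =
      2 * (‖fderiv ℝ F z w‖ ^ 2 + ⟪F z, iteratedFDeriv ℝ 2 F z ![w, w]⟫_ℝ) / ‖F z‖ ^ 2 -
        4 * ⟪F z, fderiv ℝ F z w⟫_ℝ ^ 2 / ‖F z‖ ^ 4 := by
  have hnorm : ‖F z‖ ^ 2 ≠ 0 := by simpa using h0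
  have hfirst : (fun y => fderiv ℝ (fun y => Real.log (‖F y‖ ^ 2)) y w) =ᶠ[𝓝 z]
      fun y => 2 * ⟪F y, fderiv ℝ F y w⟫_ℝ / ‖F y‖ ^ 2 := by
    filter_upwards [hF.eventually (by simp), hF.continuousAt.eventually_ne h0] with y hy hy0
    exact fderiv_log_norm_sq_apply (hy.differentiableAt two_ne_zero) hy0 w
  have hvalue : HasDerivAt (fun t : ℝ => F (z + t • w)) (fderiv ℝ F z w) 0 :=
    (hF.differentiableAt two_ne_zero).hasFDerivAt.hasLineDerivAt w
  have hvelocity : HasDerivAt (fun t : ℝ => fderiv ℝ F (z + t • w) w)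
      (iteratedFDeriv ℝ 2 F z ![w, w]) 0 :=
    hasLineDerivAt_fderiv_apply hF w
  have hquotient : HasLineDerivAt ℝ (fun y => 2 * ⟪F y, fderiv ℝ F y w⟫_ℝ / ‖F y‖ ^ 2) _ z w :=
    ((hvalue.inner ℝ hvelocity).const_mul 2).fun_div hvalue.norm_sq (by simpa using hnorm)
  rw [(hasLineDerivAt_fderiv_apply ((hF.norm_sq ℝ).log hnorm) w).unique
    (hquotient.congr_of_eventuallyEq hfirst)]
  simp only [zero_smul, add_zero, real_inner_self_eq_norm_sq]
  field_simp
  ring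

end SecondDerivative

section LeviForm

variable {E : Type*} [NormedAddCommGroup E] [NormedSpace ℂ E] [NormedSpace ℝ E]
  [IsScalarTower ℝ ℂ E] {H : Type*} [NormedAddCommGroup H] [InnerProductSpace ℂ H]

/-- The Levi form `D²φ(v, v) + D²φ(iv, iv)` of `φ`, normalized as in `HasPositiveCurvature`: it is
four times `∑ φ_{j k̄} v_j v̄_k`. -/
def leviForm (φ : E → ℝ) (z v : E) : ℝ :=
  iteratedFDeriv ℝ 2 φ z ![v, v] + iteratedFDeriv ℝ 2 φ z ![Complex.I • v, Complex.I • v]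

theorem iteratedFDeriv_two_I_smul {F : E → H} {z : E} (hF : ContDiffAt ℂ 2 F z) (v : E) :
    iteratedFDeriv ℝ 2 F z ![Complex.I • v, Complex.I • v] = -iteratedFDeriv ℝ 2 F z ![v, v] := by
  simp [← hF.restrictScalars_iteratedFDeriv (𝕜 := ℝ), iteratedFDeriv_two_apply, smul_smul]

theorem leviForm_log_norm_sq {F : E → H} {z : E} (hF : ContDiffAt ℂ 2 F z) (h0 : F z ≠ 0)
    (v : E) :
    leviForm (fun y => Real.log (‖F y‖ ^ 2)) z v =
      4 * (‖F z‖ ^ 2 * ‖fderiv ℂ F z v‖ ^ 2 - ‖⟪F z, fderiv ℂ F z v⟫_ℂ‖ ^ 2) / ‖F z‖ ^ 4 := by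
  let : InnerProductSpace ℝ H := InnerProductSpace.complexToReal
  have hre (x y : H) : ⟪x, y⟫_ℝ = (⟪x, y⟫_ℂ).re := rfl
  have hFℝ : ContDiffAt ℝ 2 F z := hF.restrict_scalars ℝ
  have hfd : fderiv ℝ F z = (fderiv ℂ F z).restrictScalars ℝ :=
    (hF.differentiableAt (by simp)).fderiv_restrictScalars ℝ
  rw [leviForm, iteratedFDeriv_two_log_norm_sq hFℝ h0, iteratedFDeriv_two_log_norm_sq hFℝ h0,
    iteratedFDeriv_two_I_smul hF, hfd]
  simp only [hre, ContinuousLinearMap.coe_restrictScalars', map_smul, inner_neg_right,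
    inner_smul_right, norm_smul, Complex.norm_I, one_mul, Complex.neg_re, Complex.I_mul_re,
    Complex.sq_norm ⟪F z, fderiv ℂ F z v⟫_ℂ, Complex.normSq_apply]
  field_simp
  ring

theorem leviForm_log_norm_sq_pos {F : E → H} {z : E} (hF : ContDiffAt ℂ 2 F z) (h0 : F z ≠ 0)
    {v : E} (hv : ∀ c : ℂ, fderiv ℂ F z v ≠ c • F z) :
    0 < leviForm (fun y => Real.log (‖F y‖ ^ 2)) z v := by
  have hcs : ‖⟪F z, fderiv ℂ F z v⟫_ℂ‖ < ‖F z‖ * ‖fderiv ℂ F z v‖ := by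
    refine (norm_inner_le_norm _ _).lt_of_ne fun h => ?_
    obtain ⟨c, -, hc⟩ := (norm_inner_eq_norm_iff h0 (by simpa using hv 0)).1 h
    exact hv c hc
  rw [leviForm_log_norm_sq hF h0, ← mul_pow]
  have hsq := pow_lt_pow_left₀ hcs (norm_nonneg _) two_ne_zero
  exact div_pos (mul_pos four_pos (sub_pos.2 hsq)) (pow_pos (norm_pos_iff.2 h0) 4)

end LeviForm

section FubiniStudy

variable {n : ℕ} {X : Type u} [TopologicalSpace X] [ChartedSpace (Fin n → ℂ) X]

theorem contMDiffOn_restrictScalars {E : Type*} [NormedAddCommGroup E] [NormedSpace ℂ E]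
    {k : WithTop ℕ∞} {f : X → E} {U : Set X}
    (hf : ContMDiffOn 𝓘(ℂ, Fin n → ℂ) 𝓘(ℂ, E) k f U) :
    ContMDiffOn 𝓘(ℝ, Fin n → ℂ) 𝓘(ℝ, E) k f U := fun x hx =>
  have h := contMDiffWithinAt_iff.1 (hf x hx)
  contMDiffWithinAt_iff.2 ⟨h.1, h.2.restrict_scalars ℝ⟩

namespace HolLineBundle

variable {L : HolLineBundle n X}

theorem IsVeryAmple.isAmple (h : L.IsVeryAmple) : L.IsAmple := by
  obtain ⟨N, s, hs, hinj, himm⟩ := h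
  refine ⟨1, le_rfl, N, fun k => ⟨(s k).val, (s k).holo, fun i j x hi hj => ?_⟩, hs, hinj, himm⟩
  simpa only [pow, pow_one] using (s k).compat i j x hi hj

theorem IsVeryAmple.isGloballyGenerated (h : L.IsVeryAmple) : L.IsGloballyGenerated := by
  obtain ⟨N, s, hs, -⟩ := h
  exact fun x => (hs _ x (L.mem_indexAt x)).imp' s fun _ => id

variable {κ : Type*}

/-- The homogeneous coordinates of the map `x ↦ [s k x]_k` to projective space, in the frame of `L`
with index `i`. -/
def homogeneousCoord (s : κ → L.HolSection) (i : L.ι) (x : X) : EuclideanSpace ℂ κ :=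
  WithLp.toLp 2 fun k => (s k).val i x

theorem homogeneousCoord_eq_smul (s : κ → L.HolSection) {i j : L.ι} {x : X} (hi : x ∈ L.dom i)
    (hj : x ∈ L.dom j) :
    homogeneousCoord s i x = L.trans i j x • homogeneousCoord s j x := by
  ext k
  exact (s k).compat i j x hi hj

theorem homogeneousCoord_ne_zero {s : κ → L.HolSection} {i : L.ι} {x : X} :
    homogeneousCoord s i x ≠ 0 ↔ ∃ k, (s k).val i x ≠ 0 := by
  simp [homogeneousCoord, funext_iff]

variable [Fintype κ]

theorem contMDiffOn_homogeneousCoord (s : κ → L.HolSection) (i : L.ι) :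
    ContMDiffOn 𝓘(ℂ, Fin n → ℂ) 𝓘(ℂ, EuclideanSpace ℂ κ) ω (homogeneousCoord s i) (L.dom i) :=
  (PiLp.contDiff_toLp (𝕜 := ℂ) (p := 2) (E := fun _ : κ => ℂ)).contMDiff.comp_contMDiffOn
    (contMDiffOn_pi_space.2 fun k => (s k).holo i)

/-- The Fubini–Study metric defined by finitely many sections without common zeros. -/
def fubiniStudy (s : κ → L.HolSection)
    (hs : ∀ i, ∀ x ∈ L.dom i, homogeneousCoord s i x ≠ 0) : L.SmoothMetric where
  val i x := (‖homogeneousCoord s i x‖ ^ 2)⁻¹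
  pos i x hx := inv_pos.2 (pow_pos (norm_pos_iff.2 (hs i x hx)) 2)
  smooth i x hx := by
    have hnorm : ContDiffAt ℝ ∞ (fun p : EuclideanSpace ℂ κ => (‖p‖ ^ 2)⁻¹)
        (homogeneousCoord s i x) :=
      (contDiff_norm_sq ℝ).contDiffAt.inv (by simpa using hs i x hx)
    have hcoord := contMDiffOn_restrictScalars (contMDiffOn_homogeneousCoord s i) x hx
    exact hnorm.contMDiffAt.comp_contMDiffWithinAt x (hcoord.of_le (by simp))
  compat i j x hi hj := by
    have htrans : ‖L.trans i j x‖ ^ 2 ≠ 0 := by simpa using L.trans_ne_zero hi hj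
    rw [homogeneousCoord_eq_smul s hi hj, norm_smul, mul_pow, mul_inv,
      mul_inv_cancel_left₀ htrans]

variable [IsManifold 𝓘(ℂ, Fin n → ℂ) ω X]

theorem contDiffAt_homogeneousCoord_comp_symm (s : κ → L.HolSection) {i : L.ι}
    {e : OpenPartialHomeomorph X (Fin n → ℂ)} (he : e ∈ atlas (Fin n → ℂ) X) {x : X}
    (hi : x ∈ L.dom i) (hx : x ∈ e.source) :
    ContDiffAt ℂ ω (homogeneousCoord s i ∘ e.symm) (e x) := by
  have hsymm : ContMDiffAt 𝓘(ℂ, Fin n → ℂ) 𝓘(ℂ, Fin n → ℂ) ω e.symm (e x) :=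
    contMDiffAt_symm_of_mem_maximalAtlas (IsManifold.subset_maximalAtlas he) (e.map_source hx)
  have hcoord : ContMDiffAt 𝓘(ℂ, Fin n → ℂ) 𝓘(ℂ, EuclideanSpace ℂ κ) ω (homogeneousCoord s i)
      (e.symm (e x)) := by
    rw [e.left_inv hx]
    exact (contMDiffOn_homogeneousCoord s i).contMDiffAt ((L.isOpen_dom i).mem_nhds hi)
  exact (hcoord.comp (e x) hsymm).contDiffAt

theorem fubiniStudy_hasPositiveCurvature (s : κ → L.HolSection)
    (hs : ∀ i, ∀ x ∈ L.dom i, homogeneousCoord s i x ≠ 0)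
    (himm : ∀ i x, x ∈ L.dom i → ∀ e ∈ atlas (Fin n → ℂ) X, x ∈ e.source →
      ∀ (v : Fin n → ℂ) (c : ℂ),
        fderiv ℂ (homogeneousCoord s i ∘ e.symm) (e x) v = c • homogeneousCoord s i x → v = 0) :
    (fubiniStudy s hs).HasPositiveCurvature := by
  intro i e he x hi hx v hv
  have hweight : (fun z => -Real.log ((fubiniStudy s hs).val i (e.symm z))) =
      fun z => Real.log (‖(homogeneousCoord s i ∘ e.symm) z‖ ^ 2) :=
    funext fun z => by rw [fubiniStudy, Real.log_inv, neg_neg, Function.comp_apply]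
  have hvalue : (homogeneousCoord s i ∘ e.symm) (e x) = homogeneousCoord s i x :=
    congrArg _ (e.left_inv hx)
  rw [hweight]
  refine leviForm_log_norm_sq_pos
    ((contDiffAt_homogeneousCoord_comp_symm s he hi hx).of_le le_top) ?_ fun c hc => ?_
  · exact hvalue ▸ hs i x hi
  · exact hv (himm i x hi e he hx v c (hc.trans (congrArg _ hvalue)))

theorem IsVeryAmple.exists_hasPositiveCurvature (h : L.IsVeryAmple) :
    ∃ hL : L.SmoothMetric, hL.HasPositiveCurvature := by
  obtain ⟨N, s, hs, -, himm⟩ := h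
  refine ⟨fubiniStudy s fun i x hx => homogeneousCoord_ne_zero.2 (hs i x hx),
    fubiniStudy_hasPositiveCurvature s _ fun i x hi e he hx v c hc =>
      himm i x hi e he hx v ⟨c, fun k => ?_⟩⟩
  have hdiff : DifferentiableAt ℂ (homogeneousCoord s i ∘ e.symm) (e x) :=
    (contDiffAt_homogeneousCoord_comp_symm s he hi hx).differentiableAt (by simp)
  have hk : HasFDerivAt ((s k).val i ∘ e.symm) _ (e x) :=
    (EuclideanSpace.proj (𝕜 := ℂ) k).hasFDerivAt.comp (e x) hdiff.hasFDerivAt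
  rw [hk.fderiv, ContinuousLinearMap.comp_apply, hc]
  rfl

end HolLineBundle

end FubiniStudy

end CanonicalAZD

end

theorem theorem2p9_general {n : ℕ} {X : Type*} [TopologicalSpace X] [CompactSpace X]
    [MeasurableSpace X] [BorelSpace X] [ChartedSpace (Fin n → ℂ) X]
    [IsManifold 𝓘(ℂ, Fin n → ℂ) ω X] :
    (∀ (A : HolLineBundle n X) (hA : A.SmoothMetric), A.IsGloballyGenerated →
      MetricLE (hHatCanOf A hA) (hCan (n := n) (X := X))) ∧
    (IsProjective n X → MetricLE (hHatCan (n := n) (X := X)) (hCan (n := n) (X := X))) := by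
  refine ⟨fun A hA hgen => hgen.hHatCanOf_le_hCan hA, fun ⟨L, hL⟩ => ?_⟩
  obtain ⟨hFS, hpos⟩ := hL.exists_hasPositiveCurvature
  exact (hHatCan_le_hHatCanOf hL.isAmple hpos).trans (hL.isGloballyGenerated.hHatCanOf_le_hCan hFS)

theorem theorem2p9 {n : ℕ} {X : Type*} [TopologicalSpace X] [T2Space X] [CompactSpace X]
    [ConnectedSpace X] [MeasurableSpace X] [BorelSpace X] [ChartedSpace (Fin n → ℂ) X]
    [IsManifold 𝓘(ℂ, Fin n → ℂ) ω X]
    (hproj : IsProjective n X) (hkod : HasNonnegKodairaDim n X) :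
    (∀ (A : HolLineBundle n X) (hA : A.SmoothMetric), hA.HasPositiveCurvature →
      IsSufficientlyAmple A hA → MetricLE (hHatCanOf A hA) (hCan (n := n) (X := X))) ∧
    MetricLE (hHatCan (n := n) (X := X)) (hCan (n := n) (X := X)) :=
  ⟨fun A hA _ hsuff => theorem2p9_general.1 A hA hsuff.2.2.isGloballyGenerated,
    theorem2p9_general.2 hproj⟩
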